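/- Let $\mathcal U$ and $\mathcal Y$ be complex Hilbert spaces, let $\mathbb C^+=\{\mu\in\mathbb C:\operatorname{Re}\mu>0\}$, and let $\varphi$ be a holomorphic function on $\mathbb C^+$ whose values are contractions from $\mathcal U$ to $\mathcal Y$. Put $\widetilde\varphi(\mu):=\varphi(\overline\mu)^*$, and let $\mathcal H_c$ be the Hilbert space of $\mathcal U$-valued functions on $\mathbb C^+$ with reproducing kernel $$K_c(\mu,\lambda)=\frac{1-\varphi(\overline\mu)^*\varphi(\overline\lambda)}{\mu+\overline\lambda},\qquad \mu,\lambda\in\mathbb C^+ .$$ Let $e_c(\lambda)$ denote evaluation at $\lambda$ on $\mathcal H_c$, so that $e_c(\lambda)^*u=K_c(\cdot,\lambda)u$. The controllable model $S_c=\left[\begin{smallmatrix}A\&B\\C\&D\end{smallmatrix}\right]_c:\mathcal H_c\oplus\mathcal U\supset\operatorname{dom}S_c\to\mathcal H_c\oplus\mathcal Y$ is the closure of the linear operator on the span of the vectors $\left[\begin{smallmatrix}e_c(\overline\lambda)^*u\\u\end{smallmatrix}\right]$ that is determined by $$\begin{bmatrix}e_c(\overline\lambda)^*u\\u\end{bmatrix}\mapsto\begin{bmatrix}\lambda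 e_c(\overline\lambda)^*u\\\varphi(\lambda)u\end{bmatrix},\qquad \lambda\in\mathbb C^+,\ u\in\mathcal U .$$ (This operator is well defined, closable and densely defined.) **Theorem.** The Hilbert space adjoint $S_c^*$ (the dual system node of $S_c$), an operator from $\mathcal H_c\oplus\mathcal Y$ to $\mathcal H_c\oplus\mathcal U$, has the domain $$\operatorname{dom}S_c^*=\left\{\begin{bmatrix}x\\y\end{bmatrix}\in\mathcal H_c\oplus\mathcal Y \;\middle|\; \exists\,u\in\mathcal U:\ \text{the function } \mu\mapsto\mu x(\mu)+\widetilde\varphi(\mu)y-u \text{ lies in } \mathcal H_c\right\}.$$ For every $\left[\begin{smallmatrix}x\\y\end{smallmatrix}\right]\in\operatorname{dom}S_c^*$ one has $S_c^*\left[\begin{smallmatrix}x\\y\end{smallmatrix}\right]=\left[\begin{smallmatrix}z\\u\end{smallmatrix}\right]$, where $$z(\mu)=\mu x(\mu)+\widetilde\varphi(\mu)y-u\quad(\mu\in\mathbb C^+),\qquad u=\lim_{\operatorname{Re}\eta\to\infty}\bigl(\eta x(\eta)+\widetilde\varphi(\eta)y\bigr),$$ the limit existing in the norm of $\mathcal U$.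 Moreover, this $u$ is the only vector in $\mathcal U$ for which $\mu\mapsto\mu x(\mu)+\widetilde\varphi(\mu)y-u$ lies in $\mathcal H_c$. -/

import Mathlib

open scoped ComplexConjugate InnerProductSpace
open Filter Topology

namespace HalfPlane

set_option linter.unusedSectionVars false

/-- The open right half-plane. -/
abbrev Cplus : Type := {μ : ℂ // 0 < μ.re}

/-- Complex conjugation on the right half-plane. -/
def Cplus.conj (μ : Cplus) : Cplus := ⟨starRingEnd ℂ μ.1, by simpa using μ.2⟩

section KernelPositivity
variable {U Y : Type*} [NormedAddCommGroup U] [InnerProductSpace ℂ U] [CompleteSpace U]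
  [NormedAddCommGroup Y] [InnerProductSpace ℂ Y] [CompleteSpace Y]

theorem differentiableAt_adjoint_conj {φ : ℂ → U →L[ℂ] Y} {μ : ℂ}
    (h : DifferentiableAt ℂ φ (conj μ)) :
    DifferentiableAt ℂ (fun ζ => ContinuousLinearMap.adjoint (φ (conj ζ))) μ := by
  have h' : HasFDerivAt φ (fderiv ℂ φ (conj μ)) ((starL ℂ : ℂ ≃L⋆[ℂ] ℂ).toContinuousLinearMap μ) :=
    h.hasFDerivAt
  exact (h'.comp_semilinear
    (ContinuousLinearMap.adjoint (𝕜 := ℂ) (E := U) (F := Y)).toContinuousLinearEquiv.toContinuousLinearMap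
    (starL ℂ : ℂ ≃L⋆[ℂ] ℂ).toContinuousLinearMap).differentiableAt

/-- The Szegő kernel of the disc with centre `c` and radius `R`, up to a constant factor. -/
noncomputable def discKernel (c R : ℝ) (ζ w : ℂ) : ℂ := ((R : ℂ) ^ 2 - (ζ - c) * (conj w - c))⁻¹

theorem discKernel_ne {c R : ℝ} (hR : 0 < R) {ζ w : ℂ} (hζ : ζ ∈ Metric.closedBall (c : ℂ) R)
    (hw : w ∈ Metric.ball (c : ℂ) R) : (R : ℂ) ^ 2 - (ζ - c) * (conj w - c) ≠ 0 := by
  intro h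
  have h1 : ‖(ζ - c) * (conj w - c)‖ = R ^ 2 := by
    rw [← sub_eq_zero.1 h]; simp [abs_of_pos hR]
  rw [mem_closedBall_iff_norm] at hζ
  rw [mem_ball_iff_norm] at hw
  have h2 : ‖conj w - (c : ℂ)‖ = ‖w - c‖ := by
    rw [← Complex.norm_conj (w - c)]; simp
  rw [norm_mul, h2] at h1
  nlinarith [norm_nonneg (ζ - c), norm_nonneg (w - c)]

theorem differentiableOn_discKernel {c R : ℝ} (hR : 0 < R) {w : ℂ}
    (hw : w ∈ Metric.ball (c : ℂ) R) :
    DifferentiableOn ℂ (fun ζ => discKernel c R ζ w) (Metric.closedBall (c : ℂ) R) := by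
  unfold discKernel
  refine DifferentiableOn.fun_inv (by fun_prop) fun ζ hζ => discKernel_ne hR hζ hw

theorem circleAverage_inner_discKernel {c R : ℝ} (hR : 0 < R) (s : Finset Cplus) (a : Cplus → U)
    (hs : ∀ i ∈ s, (i : ℂ) ∈ Metric.ball (c : ℂ) R) {G : ℂ → U}
    (hG : DiffContOnCl ℂ G (Metric.ball (c : ℂ) R)) :
    Real.circleAverage (fun ζ => ⟪∑ i ∈ s, discKernel c R ζ i • a i, G ζ⟫_ℂ) c R
      = ((R : ℂ) ^ 2)⁻¹ * ∑ i ∈ s, ⟪a i, G i⟫_ℂ := by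
  have hR0 : (R : ℂ) ≠ 0 := by exact_mod_cast hR.ne'
  have key : ∀ i ∈ s, DiffContOnCl ℂ (fun ζ => ((R : ℂ) ^ 2)⁻¹ * ⟪a i, G ζ⟫_ℂ)
      (Metric.ball (c : ℂ) |R|) := by
    intro i _
    rw [abs_of_pos hR]
    exact ((innerSL ℂ (a i)).differentiable.comp_diffContOnCl hG).const_smul (((R : ℂ) ^ 2)⁻¹)
  have h1 : Real.circleAverage (fun ζ => ⟪∑ i ∈ s, discKernel c R ζ i • a i, G ζ⟫_ℂ) c R
      = Real.circleAverage (fun ζ => ∑ i ∈ s, ((ζ - c) / (ζ - i)) •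
          (((R : ℂ) ^ 2)⁻¹ * ⟪a i, G ζ⟫_ℂ)) c R := by
    apply Real.circleAverage_congr_sphere
    intro ζ hζ
    rw [abs_of_pos hR, mem_sphere_iff_norm] at hζ
    simp only [sum_inner, inner_smul_left]
    refine Finset.sum_congr rfl fun i hi => ?_
    have hi' := hs i hi
    rw [mem_ball_iff_norm] at hi'
    have hne : ζ - i ≠ 0 := by
      intro h
      rw [sub_eq_zero.1 h] at hζ
      linarith
    have hz : ζ - c ≠ 0 := by
      intro h
      rw [h] at hζ
      simp at hζ
      linarith
    have hsq : (ζ - c) * (conj ζ - c) = (R : ℂ) ^ 2 := by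
      have := Complex.mul_conj (ζ - c)
      rw [Complex.normSq_eq_norm_sq, hζ] at this
      simpa using this
    have hk : conj (discKernel c R ζ i) = ((R : ℂ) ^ 2)⁻¹ * ((ζ - c) / (ζ - i)) := by
      have hq : (R : ℂ) ^ 2 - (conj ζ - c) * (i - c) = (R : ℂ) ^ 2 * (ζ - i) / (ζ - c) := by
        rw [eq_div_iff hz]
        linear_combination (-((i : ℂ) - c)) * hsq
      simp only [discKernel, map_inv₀, map_sub, map_mul, map_pow, Complex.conj_ofReal,
        Complex.conj_conj]
      rw [hq]
      field_simp
    rw [hk, smul_eq_mul]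
    ring
  have hint : ∀ i ∈ s, CircleIntegrable (fun ζ => ((ζ - c) / (ζ - i)) •
          (((R : ℂ) ^ 2)⁻¹ * ⟪a i, G ζ⟫_ℂ)) c R := by
    intro i hi
    apply ContinuousOn.circleIntegrable hR.le
    have hi' := hs i hi
    rw [mem_ball_iff_norm] at hi'
    refine ContinuousOn.smul (f := fun ζ : ℂ => (ζ - c) / (ζ - i))
      (ContinuousOn.div (by fun_prop) (by fun_prop) ?_) ?_
    · intro ζ hζ h
      rw [mem_sphere_iff_norm, sub_eq_zero.1 h] at hζ
      linarith
    · have := (key i hi).continuousOn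
      rw [abs_of_pos hR, closure_ball _ hR.ne'] at this
      exact this.mono Metric.sphere_subset_closedBall
  rw [h1, Real.circleAverage_fun_sum hint, Finset.mul_sum]
  refine Finset.sum_congr rfl fun i hi => ?_
  exact (key i hi).circleAverage_smul_div (by rw [abs_of_pos hR]; exact hs i hi)

theorem disc_kernel_nonneg {φ : ℂ → U →L[ℂ] Y}
    (hd : DifferentiableOn ℂ φ {μ | 0 < μ.re}) (hc : ∀ μ : ℂ, 0 < μ.re → ‖φ μ‖ ≤ 1)
    {c R : ℝ} (hR : 0 < R) (hcR : R < c) (s : Finset Cplus) (u : Cplus → U)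
    (hs : ∀ i ∈ s, (i : ℂ) ∈ Metric.ball (c : ℂ) R) :
    0 ≤ (∑ i ∈ s, ∑ j ∈ s, discKernel c R i j *
      (⟪u i, u j⟫_ℂ - ⟪φ (conj (i : ℂ)) (u i), φ (conj (j : ℂ)) (u j)⟫_ℂ)).re := by
  have hpos : ∀ ζ ∈ Metric.closedBall (c : ℂ) R, 0 < ζ.re := by
    intro ζ hζ
    rw [mem_closedBall_iff_norm] at hζ
    have h1 := (abs_le.1 (Complex.abs_re_le_norm (ζ - c))).1
    simp at h1
    linarith
  set f : ℂ → U := fun ζ => ∑ j ∈ s, discKernel c R ζ j • u j with hf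
  set g : ℂ → Y := fun ζ => ∑ j ∈ s, discKernel c R ζ j • φ (conj (j : ℂ)) (u j) with hg
  set F : ℂ → U := fun ζ => ContinuousLinearMap.adjoint (φ (conj ζ)) (g ζ) with hF
  have hfd : DifferentiableOn ℂ f (Metric.closedBall (c : ℂ) R) :=
    DifferentiableOn.fun_sum fun j hj => (differentiableOn_discKernel hR (hs j hj)).smul_const _
  have hgd : DifferentiableOn ℂ g (Metric.closedBall (c : ℂ) R) :=
    DifferentiableOn.fun_sum fun j hj => (differentiableOn_discKernel hR (hs j hj)).smul_const _
  have hopen : IsOpen {μ : ℂ | 0 < μ.re} := isOpen_lt continuous_const Complex.continuous_re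
  have had : DifferentiableOn ℂ (fun ζ => ContinuousLinearMap.adjoint (φ (conj ζ)))
      (Metric.closedBall (c : ℂ) R) := by
    intro ζ hζ
    refine (differentiableAt_adjoint_conj ?_).differentiableWithinAt
    refine hd.differentiableAt (hopen.mem_nhds ?_)
    simpa using hpos ζ hζ
  have hFd : DifferentiableOn ℂ F (Metric.closedBall (c : ℂ) R) := had.clm_apply hgd
  have hcl : closure (Metric.ball (c : ℂ) R) = Metric.closedBall (c : ℂ) R :=
    closure_ball _ hR.ne'
  have A1 := circleAverage_inner_discKernel hR s u hs
    (DifferentiableOn.diffContOnCl (by rwa [hcl]) : DiffContOnCl ℂ f (Metric.ball (c : ℂ) R))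
  have A2 := circleAverage_inner_discKernel hR s (fun j => φ (conj (j : ℂ)) (u j)) hs
    (DifferentiableOn.diffContOnCl (by rwa [hcl]) : DiffContOnCl ℂ g (Metric.ball (c : ℂ) R))
  have A3 := circleAverage_inner_discKernel hR s u hs
    (DifferentiableOn.diffContOnCl (by rwa [hcl]) : DiffContOnCl ℂ F (Metric.ball (c : ℂ) R))
  change Real.circleAverage (fun ζ => ⟪f ζ, f ζ⟫_ℂ) c R = _ at A1
  change Real.circleAverage (fun ζ => ⟪g ζ, g ζ⟫_ℂ) c R = _ at A2
  change Real.circleAverage (fun ζ => ⟪f ζ, F ζ⟫_ℂ) c R = _ at A3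
  have h23 : Real.circleAverage (fun ζ => ⟪f ζ, F ζ⟫_ℂ) c R
      = Real.circleAverage (fun ζ => ⟪g ζ, g ζ⟫_ℂ) c R := by
    rw [A2, A3]
    congr 1
    refine Finset.sum_congr rfl fun i _ => ?_
    simp only [hF, ContinuousLinearMap.adjoint_inner_right]
  have cont : ∀ {W : Type _} [NormedAddCommGroup W] [InnerProductSpace ℂ W] {p q : ℂ → W},
      DifferentiableOn ℂ p (Metric.closedBall (c : ℂ) R) →
      DifferentiableOn ℂ q (Metric.closedBall (c : ℂ) R) →
      CircleIntegrable (fun ζ => ⟪p ζ, q ζ⟫_ℂ) c R := by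
    intro W _ _ p q hp hq
    apply ContinuousOn.circleIntegrable hR.le
    exact (hp.continuousOn.inner hq.continuousOn).mono Metric.sphere_subset_closedBall
  have Iff := cont hfd hfd
  have Igg : CircleIntegrable (fun ζ => ⟪g ζ, g ζ⟫_ℂ) c R :=
    ContinuousOn.circleIntegrable hR.le ((hgd.continuousOn.inner hgd.continuousOn).mono
      Metric.sphere_subset_closedBall)
  have IfF := cont hfd hFd
  have avgre : ∀ {h : ℂ → ℂ}, CircleIntegrable h c R →
      Real.circleAverage (fun ζ => (h ζ).re) c R = (Real.circleAverage h c R).re :=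
    fun hh => Complex.reCLM.circleAverage_comp_comm hh
  have rei : ∀ {h : ℂ → ℂ}, CircleIntegrable h c R → CircleIntegrable (fun ζ => (h ζ).re) c R := by
    intro h hh
    exact ⟨hh.1.re, hh.2.re⟩
  have mono : Real.circleAverage (fun ζ => (2 : ℝ) • (⟪f ζ, F ζ⟫_ℂ).re) c R
      ≤ Real.circleAverage (fun ζ => (⟪f ζ, f ζ⟫_ℂ).re + (⟪g ζ, g ζ⟫_ℂ).re) c R := by
    refine Real.circleAverage_mono ((rei IfF).const_smul (a := (2 : ℝ)))
      ((rei Iff).add (rei Igg)) fun ζ hζ => ?_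
    rw [abs_of_pos hR] at hζ
    have hζ' := hpos ζ (Metric.sphere_subset_closedBall hζ)
    have e1 : (⟪f ζ, f ζ⟫_ℂ).re = ‖f ζ‖ ^ 2 := inner_self_eq_norm_sq (𝕜 := ℂ) (f ζ)
    have e2 : (⟪g ζ, g ζ⟫_ℂ).re = ‖g ζ‖ ^ 2 := inner_self_eq_norm_sq (𝕜 := ℂ) (g ζ)
    have e3 : (⟪f ζ, F ζ⟫_ℂ).re ≤ ‖f ζ‖ * ‖F ζ‖ := re_inner_le_norm (𝕜 := ℂ) (f ζ) (F ζ)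
    have e4 : ‖F ζ‖ ≤ ‖g ζ‖ := by
      refine (ContinuousLinearMap.le_opNorm _ _).trans ?_
      have : ‖ContinuousLinearMap.adjoint (φ (conj ζ))‖ ≤ 1 := by
        rw [LinearIsometryEquiv.norm_map]
        exact hc _ (by simpa using hζ')
      nlinarith [norm_nonneg (g ζ)]
    simp only [smul_eq_mul]
    rw [e1, e2]
    nlinarith [norm_nonneg (f ζ), norm_nonneg (F ζ), norm_nonneg (g ζ), sq_nonneg (‖f ζ‖ - ‖g ζ‖)]
  rw [Real.circleAverage_fun_smul, Real.circleAverage_fun_add (rei Iff) (rei Igg), avgre Iff, avgre Igg,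
    avgre IfF, h23, A1, A2, smul_eq_mul] at mono
  have hR2 : ((R : ℂ) ^ 2)⁻¹ = (((R ^ 2)⁻¹ : ℝ) : ℂ) := by push_cast; rfl
  rw [hR2, Complex.re_ofReal_mul, Complex.re_ofReal_mul] at mono
  have hR3 : 0 < (R ^ 2)⁻¹ := by positivity
  have hfin : (∑ i ∈ s, ⟪φ (conj (i : ℂ)) (u i), g i⟫_ℂ).re ≤ (∑ i ∈ s, ⟪u i, f i⟫_ℂ).re := by
    nlinarith
  have : (∑ i ∈ s, ∑ j ∈ s, discKernel c R i j *
      (⟪u i, u j⟫_ℂ - ⟪φ (conj (i : ℂ)) (u i), φ (conj (j : ℂ)) (u j)⟫_ℂ))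
      = (∑ i ∈ s, ⟪u i, f i⟫_ℂ) - ∑ i ∈ s, ⟪φ (conj (i : ℂ)) (u i), g i⟫_ℂ := by
    simp only [hf, hg, inner_sum, inner_smul_right, mul_sub, Finset.sum_sub_distrib]
  rw [this, Complex.sub_re]
  linarith

theorem halfPlane_kernel_nonneg {φ : ℂ → U →L[ℂ] Y}
    (hd : DifferentiableOn ℂ φ {μ | 0 < μ.re}) (hc : ∀ μ : ℂ, 0 < μ.re → ‖φ μ‖ ≤ 1)
    (s : Finset Cplus) (u : Cplus → U) :
    0 ≤ (∑ i ∈ s, ∑ j ∈ s, ((i : ℂ) + conj (j : ℂ))⁻¹ *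
      (⟪u i, u j⟫_ℂ - ⟪φ (conj (i : ℂ)) (u i), φ (conj (j : ℂ)) (u j)⟫_ℂ)).re := by
  -- the discs of centre `c` and radius `√(c² - 1)` exhaust the half-plane as `c → ∞`
  have hlim : ∀ i j : Cplus, Tendsto (fun c : ℝ => (c : ℂ) * discKernel c √(c ^ 2 - 1) i j) atTop
      (𝓝 (((i : ℂ) + conj (j : ℂ))⁻¹)) := by
    intro i j
    have hij : (i : ℂ) + conj (j : ℂ) ≠ 0 := by
      intro h
      have := congrArg Complex.re h
      have hi := i.2
      have hj := j.2
      simp at this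
      linarith
    have h1 : Tendsto (fun c : ℝ => ((i : ℂ) + conj (j : ℂ)) - ((c⁻¹ : ℝ) : ℂ) * (i * conj (j : ℂ) + 1))
        atTop (𝓝 ((i : ℂ) + conj (j : ℂ) - ((0 : ℝ) : ℂ) * (i * conj (j : ℂ) + 1))) :=
      tendsto_const_nhds.sub
        (((Complex.continuous_ofReal.tendsto 0).comp tendsto_inv_atTop_zero).mul tendsto_const_nhds)
    simp only [Complex.ofReal_zero, zero_mul, sub_zero] at h1
    refine (h1.inv₀ hij).congr' ?_
    filter_upwards [eventually_gt_atTop 1] with c hc1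
    have hc0 : (c : ℂ) ≠ 0 := by exact_mod_cast (by linarith : c ≠ 0)
    have hsq : ((√(c ^ 2 - 1) : ℝ) : ℂ) ^ 2 = (c : ℂ) ^ 2 - 1 := by
      rw [← Complex.ofReal_pow, Real.sq_sqrt (by nlinarith)]
      push_cast; rfl
    rw [discKernel, hsq, ← inv_inv (c : ℂ), ← mul_inv]
    congr 1
    push_cast
    rw [inv_inv]
    field_simp
    ring
  have hball : ∀ i : Cplus, ∀ᶠ c : ℝ in atTop, (i : ℂ) ∈ Metric.ball (c : ℂ) √(c ^ 2 - 1) := by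
    intro i
    have hi := i.2
    filter_upwards [eventually_gt_atTop 1,
      eventually_gt_atTop ((Complex.normSq i + 1) / (2 * (i : ℂ).re))] with c h1 h2
    rw [div_lt_iff₀ (by positivity)] at h2
    rw [mem_ball_iff_norm]
    apply Real.lt_sqrt_of_sq_lt
    rw [← Complex.normSq_eq_norm_sq, Complex.normSq_apply]
    rw [Complex.normSq_apply] at h2
    simp
    nlinarith
  have hT : Tendsto (fun c : ℝ => (∑ i ∈ s, ∑ j ∈ s, ((c : ℂ) * discKernel c √(c ^ 2 - 1) i j) *
      (⟪u i, u j⟫_ℂ - ⟪φ (conj (i : ℂ)) (u i), φ (conj (j : ℂ)) (u j)⟫_ℂ)).re) atTop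
      (𝓝 (∑ i ∈ s, ∑ j ∈ s, ((i : ℂ) + conj (j : ℂ))⁻¹ *
      (⟪u i, u j⟫_ℂ - ⟪φ (conj (i : ℂ)) (u i), φ (conj (j : ℂ)) (u j)⟫_ℂ)).re) :=
    (Complex.continuous_re.tendsto _).comp (tendsto_finsetSum _ fun i _ => tendsto_finsetSum _
      fun j _ => (hlim i j).mul_const _)
  refine ge_of_tendsto hT ?_
  filter_upwards [(Finset.eventually_all s).2 fun i _ => hball i, eventually_gt_atTop 1] with c hcs hc1
  have hpos : 0 < c ^ 2 - 1 := by nlinarith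
  have := disc_kernel_nonneg hd hc (Real.sqrt_pos.2 hpos)
    ((Real.sqrt_lt' (by linarith)).2 (by linarith) : √(c ^ 2 - 1) < c) s u hcs
  simp only [mul_assoc, ← Finset.mul_sum]
  rw [Complex.re_ofReal_mul]
  exact mul_nonneg (by linarith) this

end KernelPositivity

/-- The Schur class of the right half-plane: functions that are holomorphic on the open right
half-plane and whose values there are contractions from `U` to `Y`. The values of `toFun` outside
the half-plane play no role. -/
structure SchurFunction (U Y : Type*) [NormedAddCommGroup U] [InnerProductSpace ℂ U]
    [NormedAddCommGroup Y] [InnerProductSpace ℂ Y] where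
  toFun : ℂ → U →L[ℂ] Y
  holomorphic : DifferentiableOn ℂ toFun {μ | 0 < μ.re}
  contractive : ∀ μ : ℂ, 0 < μ.re → ‖toFun μ‖ ≤ 1

section Model

variable {U Y : Type*} [NormedAddCommGroup U] [InnerProductSpace ℂ U] [CompleteSpace U]
  [NormedAddCommGroup Y] [InnerProductSpace ℂ Y] [CompleteSpace Y]

/-- `φ̃(μ) = φ(μ̄)*`. -/
noncomputable def SchurFunction.tilde (φ : SchurFunction U Y) (μ : Cplus) : Y →L[ℂ] U :=
  ContinuousLinearMap.adjoint (φ.toFun μ.conj)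

/-- The kernel `K_c(μ, lam) = (1 - φ(μ̄)* φ(lam̄)) / (μ + lam̄)`. -/
noncomputable def Kc (φ : SchurFunction U Y) : Matrix Cplus Cplus (U →L[ℂ] U) :=
  Matrix.of fun μ lam =>
    ((μ : ℂ) + conj (lam : ℂ))⁻¹ •
      (ContinuousLinearMap.id ℂ U - φ.tilde μ ∘L φ.toFun lam.conj)

theorem inner_Kc (φ : SchurFunction U Y) (μ lam : Cplus) (u v : U) :
    ⟪v, Kc φ μ lam u⟫_ℂ = ((μ : ℂ) + conj (lam : ℂ))⁻¹ *
      (⟪v, u⟫_ℂ - ⟪φ.toFun (conj (μ : ℂ)) v, φ.toFun (conj (lam : ℂ)) u⟫_ℂ) := by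
  simp [Kc, SchurFunction.tilde, Cplus.conj,
    ContinuousLinearMap.adjoint_inner_right]

instance Kc_posSemidef (φ : SchurFunction U Y) : Fact (Kc φ).PosSemidef := by
  have tfae := (RKHS.posSemidef_tfae (K := Kc φ)).out 0 2
  refine ⟨tfae.2 ⟨?_, fun vv => ?_⟩⟩
  · ext μ lam u
    refine ext_inner_left ℂ fun v => ?_
    rw [Matrix.conjTranspose_apply, ContinuousLinearMap.star_eq_adjoint,
      ContinuousLinearMap.adjoint_inner_right, ← inner_conj_symm, inner_Kc, inner_Kc]
    simp [add_comm]
  · have h := halfPlane_kernel_nonneg φ.holomorphic φ.contractive vv.support vv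
    have e : vv.sum (fun x w => vv.sum fun x' w' => ⟪Kc φ x' x w, w'⟫_ℂ)
        = conj (∑ i ∈ vv.support, ∑ j ∈ vv.support, ((i : ℂ) + conj (j : ℂ))⁻¹ *
      (⟪vv i, vv j⟫_ℂ - ⟪φ.toFun (conj (i : ℂ)) (vv i), φ.toFun (conj (j : ℂ)) (vv j)⟫_ℂ)) := by
      rw [map_sum, Finsupp.sum]
      simp only [map_sum, Finsupp.sum]
      rw [Finset.sum_comm]
      refine Finset.sum_congr rfl fun i _ => Finset.sum_congr rfl fun j _ => ?_
      rw [← inner_conj_symm, inner_Kc]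
    rw [e]
    exact (RCLike.conj_re (K := ℂ) _).symm ▸ h

/-- The de Branges-Rovnyak space `H_c`: the Hilbert space of `U`-valued functions on the right
half-plane with reproducing kernel `K_c` (that `RKHS.kernel (Hc φ) = Kc φ` is
`RKHS.OfKernel.kernel_ofKernel`). A function belongs to the space if it is the coercion of an
element. -/
abbrev Hc (φ : SchurFunction U Y) := RKHS.OfKernel (Kc φ)

/-- The linear span of the pairs
`([e_c(lam̄)* u ; u], [lam e_c(lam̄)* u ; φ(lam) u])`, `lam` in the right half-plane, `u ∈ U`,
where `e_c(·)* = RKHS.kerFun` is the adjoint of point evaluation in `H_c`. -/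
noncomputable def preGraph (φ : SchurFunction U Y) :
    Submodule ℂ (WithLp 2 (Hc φ × U) × WithLp 2 (Hc φ × Y)) :=
  Submodule.span ℂ {p | ∃ (lam : Cplus) (u : U),
    p = (WithLp.toLp 2 (RKHS.kerFun (Hc φ) lam.conj u, u),
      WithLp.toLp 2 ((lam : ℂ) • RKHS.kerFun (Hc φ) lam.conj u, φ.toFun lam u))}

/-- The operator on `span {[e_c(lam̄)* u ; u]}` with graph `preGraph φ` (see `preModel_graph`). -/
noncomputable def preModel (φ : SchurFunction U Y) :
    WithLp 2 (Hc φ × U) →ₗ.[ℂ] WithLp 2 (Hc φ × Y) :=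
  (preGraph φ).toLinearPMap

/-- The controllable functional model of `φ`: the closure of `preModel φ`. Its graph is
the closure of the span `preGraph φ` (`model_graph`) and its domain is dense (`model_dense`), so
that `(model φ).adjoint` is the genuine Hilbert space adjoint. -/
noncomputable def model (φ : SchurFunction U Y) :
    WithLp 2 (Hc φ × U) →ₗ.[ℂ] WithLp 2 (Hc φ × Y) :=
  (preModel φ).closure

theorem kerFun_inner_kerFun (φ : SchurFunction U Y) (μ lam : Cplus) (u v : U) :
    ⟪RKHS.kerFun (Hc φ) μ.conj v, RKHS.kerFun (Hc φ) lam.conj u⟫_ℂ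
      = (conj (μ : ℂ) + lam)⁻¹ * (⟪v, u⟫_ℂ - ⟪φ.toFun μ v, φ.toFun lam u⟫_ℂ) := by
  rw [RKHS.kerFun_inner, RKHS.kerFun_apply, RKHS.OfKernel.kernel_ofKernel, inner_Kc]
  simp [Cplus.conj]

/-- The power-balance form of a pair of graph elements. -/
noncomputable def balance {H : Type*} [NormedAddCommGroup H] [InnerProductSpace ℂ H]
    (p q : WithLp 2 (H × U) × WithLp 2 (H × Y)) : ℂ :=
  ⟪p.2.fst, q.1.fst⟫_ℂ + ⟪p.1.fst, q.2.fst⟫_ℂ - ⟪p.1.snd, q.1.snd⟫_ℂ + ⟪p.2.snd, q.2.snd⟫_ℂ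

theorem balance_eq_zero_of_mem_closure {H : Type*} [NormedAddCommGroup H] [InnerProductSpace ℂ H]
    {s : Set (WithLp 2 (H × U) × WithLp 2 (H × Y))} (hs : ∀ p ∈ s, ∀ q ∈ s, balance p q = 0)
    {p q : WithLp 2 (H × U) × WithLp 2 (H × Y)} (hp : p ∈ closure s) (hq : q ∈ closure s) :
    balance p q = 0 := by
  have c1 : Continuous fun r : WithLp 2 (H × U) => r.fst :=
    continuous_fst.comp (WithLp.prod_continuous_ofLp 2 H U)
  have c2 : Continuous fun r : WithLp 2 (H × U) => r.snd :=
    continuous_snd.comp (WithLp.prod_continuous_ofLp 2 H U)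
  have c3 : Continuous fun r : WithLp 2 (H × Y) => r.fst :=
    continuous_fst.comp (WithLp.prod_continuous_ofLp 2 H Y)
  have c4 : Continuous fun r : WithLp 2 (H × Y) => r.snd :=
    continuous_snd.comp (WithLp.prod_continuous_ofLp 2 H Y)
  have hc : ∀ a : WithLp 2 (H × U) × WithLp 2 (H × Y), Continuous fun b => balance a b := fun a =>
    (((continuous_const.inner (c1.comp continuous_fst)).add
      (continuous_const.inner (c3.comp continuous_snd))).sub
      (continuous_const.inner (c2.comp continuous_fst))).add
      (continuous_const.inner (c4.comp continuous_snd))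
  have hc' : ∀ b : WithLp 2 (H × U) × WithLp 2 (H × Y), Continuous fun a => balance a b := fun b =>
    ((((c3.comp continuous_snd).inner continuous_const).add
      ((c1.comp continuous_fst).inner continuous_const)).sub
      ((c2.comp continuous_fst).inner continuous_const)).add
      ((c4.comp continuous_snd).inner continuous_const)
  have h1 : ∀ a ∈ s, balance a q = 0 := fun a ha =>
    closure_minimal (t := {b | balance a b = 0}) (fun b hb => hs a ha b hb)
      (isClosed_eq (hc a) continuous_const) hq
  exact closure_minimal (t := {a | balance a q = 0}) (fun a ha => h1 a ha)
    (isClosed_eq (hc' q) continuous_const) hp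

theorem balance_preGraph {φ : SchurFunction U Y}
    {p q : WithLp 2 (Hc φ × U) × WithLp 2 (Hc φ × Y)} (hp : p ∈ preGraph φ) (hq : q ∈ preGraph φ) :
    balance p q = 0 := by
  induction hp using Submodule.span_induction with
  | mem p hp =>
    obtain ⟨μ, v, rfl⟩ := hp
    induction hq using Submodule.span_induction with
    | mem q hq =>
      obtain ⟨lam, u, rfl⟩ := hq
      have hne : conj (μ : ℂ) + (lam : ℂ) ≠ 0 := by
        intro h
        have := congrArg Complex.re h
        have h1 := μ.2
        have h2 := lam.2
        simp at this
        linarith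
      simp only [balance, WithLp.toLp_fst, WithLp.toLp_snd, inner_smul_left, inner_smul_right,
        kerFun_inner_kerFun]
      field_simp
      ring
    | zero => simp [balance]
    | add a b _ _ ha hb =>
      simp only [balance, Prod.fst_add, Prod.snd_add, WithLp.add_fst, WithLp.add_snd,
        inner_add_right] at ha hb ⊢
      linear_combination ha + hb
    | smul c a _ ha =>
      simp only [balance, Prod.smul_fst, Prod.smul_snd, WithLp.smul_fst, WithLp.smul_snd,
        inner_smul_right] at ha ⊢
      linear_combination c * ha
  | zero => simp [balance]
  | add a b _ _ ha hb =>
    simp only [balance, Prod.fst_add, Prod.snd_add, WithLp.add_fst, WithLp.add_snd,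
      inner_add_left] at ha hb ⊢
    linear_combination ha + hb
  | smul c a _ ha =>
    simp only [balance, Prod.smul_fst, Prod.smul_snd, WithLp.smul_fst, WithLp.smul_snd,
      inner_smul_left] at ha ⊢
    linear_combination conj c * ha

theorem balance_closure {φ : SchurFunction U Y}
    {p q : WithLp 2 (Hc φ × U) × WithLp 2 (Hc φ × Y)} (hp : p ∈ (preGraph φ).topologicalClosure)
    (hq : q ∈ (preGraph φ).topologicalClosure) :
    balance p q = 0 :=
  balance_eq_zero_of_mem_closure
    (s := (preGraph φ : Set (WithLp 2 (Hc φ × U) × WithLp 2 (Hc φ × Y))))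
    (fun _ ha _ hb => balance_preGraph ha hb) hp hq

theorem closure_preGraph_single {φ : SchurFunction U Y}
    {p : WithLp 2 (Hc φ × U) × WithLp 2 (Hc φ × Y)} (hp : p ∈ (preGraph φ).topologicalClosure)
    (h0 : p.1 = 0) : p.2 = 0 := by
  have h1 := balance_closure hp hp
  simp only [balance, h0, WithLp.zero_fst, WithLp.zero_snd, inner_zero_left, inner_zero_right,
    add_zero, sub_zero, zero_add, inner_self_eq_zero] at h1
  have h2 : p.2.fst = 0 := by
    refine DFunLike.ext _ _ fun μ => ext_inner_right ℂ fun u => ?_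
    have hq : (WithLp.toLp 2 (RKHS.kerFun (Hc φ) μ.conj.conj u, u),
      WithLp.toLp 2 ((μ.conj : ℂ) • RKHS.kerFun (Hc φ) μ.conj.conj u, φ.toFun μ.conj u))
        ∈ preGraph φ := Submodule.subset_span ⟨μ.conj, u, rfl⟩
    have h3 := balance_closure hp ((preGraph φ).le_topologicalClosure hq)
    have hμ : μ.conj.conj = μ := by ext; simp [Cplus.conj]
    simp only [balance, h0, h1, WithLp.zero_fst, WithLp.zero_snd, inner_zero_left,
      add_zero, sub_zero, hμ] at h3
    simpa using h3
  exact WithLp.ofLp_injective 2 (Prod.ext h2 h1)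

theorem preModel_graph (φ : SchurFunction U Y) : (preModel φ).graph = preGraph φ :=
  Submodule.toLinearPMap_graph_eq _ fun _ hp h0 =>
    closure_preGraph_single ((preGraph φ).le_topologicalClosure hp) h0

theorem preModel_isClosable (φ : SchurFunction U Y) : (preModel φ).IsClosable := by
  refine ⟨(preGraph φ).topologicalClosure.toLinearPMap, ?_⟩
  rw [preModel_graph, Submodule.toLinearPMap_graph_eq]
  exact fun _ hp h0 => closure_preGraph_single hp h0

theorem model_graph (φ : SchurFunction U Y) :
    (model φ).graph = (preGraph φ).topologicalClosure := by
  rw [model, ← (preModel_isClosable φ).graph_closure_eq_closure_graph, preModel_graph]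

theorem Hc_norm_apply_le {φ : SchurFunction U Y} (x : Hc φ) (μ : Cplus) :
    ‖x μ‖ ≤ ‖x‖ * √((μ : ℂ).re⁻¹) := by
  refine (RKHS.norm_apply_le x μ).trans ?_
  gcongr
  rw [RKHS.OfKernel.kernel_ofKernel]
  have hμ := μ.2
  have h1 : ‖φ.tilde μ ∘L φ.toFun μ.conj‖ ≤ 1 := by
    refine (ContinuousLinearMap.opNorm_comp_le _ _).trans ?_
    have h2 : ‖φ.toFun μ.conj‖ ≤ 1 := φ.contractive _ μ.conj.2
    rw [SchurFunction.tilde, LinearIsometryEquiv.norm_map]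
    nlinarith [norm_nonneg (φ.toFun μ.conj)]
  have h3 : ‖ContinuousLinearMap.id ℂ U - φ.tilde μ ∘L φ.toFun μ.conj‖ ≤ 2 := by
    refine (norm_sub_le _ _).trans ?_
    linarith [ContinuousLinearMap.norm_id_le (𝕜 := ℂ) (E := U)]
  have h4 : (μ : ℂ) + conj (μ : ℂ) = ((2 * (μ : ℂ).re : ℝ) : ℂ) := by
    rw [Complex.add_conj]
  rw [Kc, Matrix.of_apply, norm_smul, h4, norm_inv, Complex.norm_real, Real.norm_eq_abs,
    abs_of_pos (by positivity), mul_inv]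
  have : 0 < ((μ : ℂ).re)⁻¹ := inv_pos.2 hμ
  nlinarith

theorem model_dense (φ : SchurFunction U Y) :
    Dense ((model φ).domain : Set (WithLp 2 (Hc φ × U))) := by
  rw [Submodule.dense_iff_topologicalClosure_eq_top, Submodule.topologicalClosure_eq_top_iff,
    Submodule.eq_bot_iff]
  intro w hw
  have hmem : ∀ (μ : Cplus) (u : U),
      WithLp.toLp 2 (RKHS.kerFun (Hc φ) μ.conj u, u) ∈ (model φ).domain := by
    intro μ u
    have : (WithLp.toLp 2 (RKHS.kerFun (Hc φ) μ.conj u, u),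
      WithLp.toLp 2 ((μ : ℂ) • RKHS.kerFun (Hc φ) μ.conj u, φ.toFun μ u)) ∈ (model φ).graph := by
      rw [model_graph]
      exact (preGraph φ).le_topologicalClosure (Submodule.subset_span ⟨μ, u, rfl⟩)
    exact LinearPMap.mem_domain_of_mem_graph this
  have h1 : ∀ μ : Cplus, w.fst μ = -w.snd := by
    intro μ
    have hμ : μ.conj.conj = μ := by ext; simp [Cplus.conj]
    refine ext_inner_left ℂ fun u => ?_
    have := (Submodule.mem_orthogonal _ _).1 hw _ (hmem μ.conj u)
    rw [WithLp.prod_inner_apply] at this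
    simp only [hμ, RKHS.kerFun_inner] at this
    rw [inner_neg_right]
    exact eq_neg_of_add_eq_zero_left this
  have h2 : w.snd = 0 := by
    have hT : Tendsto (fun t : ℝ => ‖w.fst‖ * √(t⁻¹)) atTop (𝓝 0) := by
      have := (Real.continuous_sqrt.tendsto 0).comp tendsto_inv_atTop_zero
      simpa using this.const_mul ‖w.fst‖
    have : ‖w.snd‖ ≤ 0 := by
      refine ge_of_tendsto hT ?_
      filter_upwards [eventually_gt_atTop 0] with t ht
      have := Hc_norm_apply_le w.fst (⟨(t : ℂ), by simpa using ht⟩ : Cplus)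
      rw [h1, norm_neg] at this
      simpa using this
    exact norm_le_zero_iff.1 this
  have h3 : w.fst = 0 := DFunLike.ext _ _ fun μ => by rw [h1, h2]; simp
  exact WithLp.ofLp_injective 2 (Prod.ext h3 h2)

end Model

end HalfPlane

open HalfPlane

namespace HalfPlane

section AdjointModel

variable {U Y : Type*} [NormedAddCommGroup U] [InnerProductSpace ℂ U] [CompleteSpace U]
  [NormedAddCommGroup Y] [InnerProductSpace ℂ Y] [CompleteSpace Y]

/-! A pair lies in the graph of the adjoint exactly when it satisfies the adjointness relation
against the graph of `model φ`. That relation is linear and closed, so it need only be tested on the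
generators of `preGraph φ`. On the generator at `lam` with vector `v`, the reproducing property
turns it into an identity between values at the conjugate point, tested against `v`. Letting `v` and
`lam` vary gives the pointwise formula for `z`, in both directions (`mem_graph_adjoint_model`).

The vector `u` is then forced by decay: elements of `Hc φ` are `O((Re η)^(-1/2))`, so `z η → 0` and
the function `η x(η) + φ̃(η) y` tends to `u` (`tendsto_of_eq_sub`). This yields the limit formula
and, limits being unique, the uniqueness of `u`. -/

theorem Cplus.conj_conj (μ : Cplus) : μ.conj.conj = μ := by
  ext
  simp [Cplus.conj]

/-! ### The adjoint graph, tested on kernel functions -/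

/-- An adjointness relation that holds on generators holds on the closure of their span. -/
theorem inner_eq_of_mem_topologicalClosure_span {E F : Type*}
    [NormedAddCommGroup E] [InnerProductSpace ℂ E] [NormedAddCommGroup F] [InnerProductSpace ℂ F]
    {s : Set (E × F)} {v : E} {w : F} (h : ∀ p ∈ s, ⟪p.2, w⟫_ℂ = ⟪p.1, v⟫_ℂ)
    {p : E × F} (hp : p ∈ (Submodule.span ℂ s).topologicalClosure) : ⟪p.2, w⟫_ℂ = ⟪p.1, v⟫_ℂ := by
  refine closure_minimal (s := (Submodule.span ℂ s : Set (E × F)))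
    (t := {p | ⟪p.2, w⟫_ℂ = ⟪p.1, v⟫_ℂ}) (fun q hq => ?_)
    (isClosed_eq (continuous_snd.inner continuous_const) (continuous_fst.inner continuous_const)) hp
  change ⟪q.2, w⟫_ℂ = ⟪q.1, v⟫_ℂ
  -- Both sides are conjugate-linear in the pair, so the relation passes to linear combinations;
  -- closedness was used above to pass to limits.
  induction hq using Submodule.span_induction with
  | mem q hq => exact h q hq
  | zero => simp
  | add a b _ _ ha hb => simp only [Prod.fst_add, Prod.snd_add, inner_add_left, ha, hb]
  | smul c a _ ha => simp only [Prod.smul_fst, Prod.smul_snd, inner_smul_left, ha]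

/-- The graph of the adjoint of the controllable model. -/
theorem mem_graph_adjoint_model (φ : SchurFunction U Y) (x z : Hc φ) (y : Y) (u : U) :
    (WithLp.toLp 2 (x, y), WithLp.toLp 2 (z, u)) ∈ (model φ).adjoint.graph ↔
      ∀ μ : Cplus, z μ = (μ : ℂ) • x μ + φ.tilde μ y - u := by
  -- Pairing with a kernel function at `lam.conj` evaluates there. The scalar `lam` leaves the first
  -- slot conjugated, and the adjoint of `φ.toFun lam` is `φ.tilde lam.conj`, so every term lives at
  -- the single point `lam.conj`.
  have key : ∀ (lam : Cplus) (v : U),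
      (⟪WithLp.toLp 2 ((lam : ℂ) • RKHS.kerFun (Hc φ) lam.conj v, φ.toFun lam v),
          WithLp.toLp 2 (x, y)⟫_ℂ
        = ⟪WithLp.toLp 2 (RKHS.kerFun (Hc φ) lam.conj v, v), WithLp.toLp 2 (z, u)⟫_ℂ) ↔
      ⟪v, (lam.conj : ℂ) • x lam.conj + φ.tilde lam.conj y⟫_ℂ = ⟪v, z lam.conj + u⟫_ℂ := by
    intro lam v
    simp only [WithLp.prod_inner_apply, inner_smul_left, RKHS.kerFun_inner, inner_add_right,
      inner_smul_right, SchurFunction.tilde, ContinuousLinearMap.adjoint_inner_right,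
      Cplus.conj_conj]
    rfl
  -- Density of the domain makes the operator adjoint agree with the adjoint of the graph as a
  -- linear relation.
  rw [LinearPMap.adjoint_graph_eq_graph_adjoint (model_dense φ), Submodule.mem_adjoint_iff,
    model_graph]
  constructor
  · intro h μ
    -- The value at `μ` is reached through the generator with parameter `μ.conj`.
    rw [eq_sub_iff_add_eq, eq_comm, ← Cplus.conj_conj μ]
    refine ext_inner_left ℂ fun v => (key μ.conj v).1 (sub_eq_zero.1 (h _ _ ?_))
    exact (preGraph φ).le_topologicalClosure (Submodule.subset_span ⟨μ.conj, v, rfl⟩)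
  · intro h a b hab
    refine sub_eq_zero.2 (inner_eq_of_mem_topologicalClosure_span ?_ hab)
    rintro _ ⟨lam, v, rfl⟩
    refine (key lam v).2 ?_
    rw [h, sub_add_cancel]

/-! ### Decay as the real part tends to infinity -/

/-- The kernel bound `‖z η‖ ≤ ‖z‖ √(1 / Re η)` involves only the real part, so the decay is uniform
in `Im η`; the filter accordingly leaves the imaginary part free. -/
theorem tendsto_Hc_apply_zero {φ : SchurFunction U Y} (z : Hc φ) :
    Tendsto (fun η : Cplus => z η) (comap (fun η : Cplus => (η : ℂ).re) atTop) (𝓝 0) := by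
  have hT : Tendsto (fun t : ℝ => ‖z‖ * √(t⁻¹)) atTop (𝓝 0) := by
    have := (Real.continuous_sqrt.tendsto 0).comp tendsto_inv_atTop_zero
    simpa using this.const_mul ‖z‖
  exact squeeze_zero_norm (Hc_norm_apply_le z) (hT.comp tendsto_comap)

/-- Needed for limits along this filter to be unique; large positive reals serve as witnesses. -/
instance comap_re_atTop_neBot : (comap (fun η : Cplus => (η : ℂ).re) atTop).NeBot := by
  refine comap_neBot_iff.2 fun t ht => ?_
  obtain ⟨r, hr, hr0⟩ := (((eventually_mem_set.2 ht)).and (eventually_gt_atTop (0 : ℝ))).exists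
  exact ⟨⟨(r : ℂ), by simpa using hr0⟩, by simpa using hr⟩

/-- Here `f = z + u` with `z` vanishing at infinity, so any admissible constant `u` is recovered
from `f` alone. -/
theorem tendsto_of_eq_sub {φ : SchurFunction U Y} {f : Cplus → U} {z : Hc φ} {u : U}
    (h : ∀ μ : Cplus, z μ = f μ - u) :
    Tendsto f (comap (fun η : Cplus => (η : ℂ).re) atTop) (𝓝 u) := by
  have := (tendsto_Hc_apply_zero z).add_const u
  simpa [h] using this

end AdjointModel

end HalfPlane

theorem theorem4p4 {U Y : Type*}
    [NormedAddCommGroup U] [InnerProductSpace ℂ U] [CompleteSpace U]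
    [NormedAddCommGroup Y] [InnerProductSpace ℂ Y] [CompleteSpace Y]
    (φ : SchurFunction U Y) :
    (∀ (x : Hc φ) (y : Y), WithLp.toLp 2 (x, y) ∈ (model φ).adjoint.domain ↔
      ∃ (u : U) (z : Hc φ), ∀ μ : Cplus, z μ = (μ : ℂ) • x μ + φ.tilde μ y - u) ∧
    ∀ (x : Hc φ) (y : Y) (h : WithLp.toLp 2 (x, y) ∈ (model φ).adjoint.domain),
      ∃ (z : Hc φ) (u : U),
        (model φ).adjoint ⟨WithLp.toLp 2 (x, y), h⟩ = WithLp.toLp 2 (z, u) ∧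
        (∀ μ : Cplus, z μ = (μ : ℂ) • x μ + φ.tilde μ y - u) ∧
        Tendsto (fun η : Cplus => (η : ℂ) • x η + φ.tilde η y)
          (comap (fun η : Cplus => (η : ℂ).re) atTop) (𝓝 u) ∧
        ∀ u' : U,
          (∃ z' : Hc φ, ∀ μ : Cplus, z' μ = (μ : ℂ) • x μ + φ.tilde μ y - u') → u' = u := by
  refine ⟨fun x y => ⟨fun h => ?_, ?_⟩, fun x y h => ?_⟩
  · exact ⟨_, _, (mem_graph_adjoint_model φ x _ y _).1 ((model φ).adjoint.mem_graph ⟨_, h⟩)⟩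
  · rintro ⟨u, z, hz⟩
    exact LinearPMap.mem_domain_of_mem_graph ((mem_graph_adjoint_model φ x z y u).2 hz)
  · have hz := (mem_graph_adjoint_model φ x _ y _).1 ((model φ).adjoint.mem_graph ⟨_, h⟩)
    -- The witnesses are the two components of the adjoint's value.
    refine ⟨_, _, rfl, hz, tendsto_of_eq_sub hz, ?_⟩
    rintro u' ⟨z', hz'⟩
    -- Both `u'` and `u` are limits of the same function.
    exact tendsto_nhds_unique (tendsto_of_eq_sub hz') (tendsto_of_eq_sub hz)
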